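/- Let $p$ be a prime, $n\ge 0$ an integer, and let $F(n)$ be the free pro-$p$ group on $x_1,\dots,x_n$, that is, the inverse limit of the quotients of the discrete free group $F_n$ on $x_1,\dots,x_n$ by its normal subgroups of $p$-power index. Let $K\subseteq\{1,\dots,n\}$, and let $H=F(K)$ be the closed subgroup of $F(n)$ topologically generated by $\{x_j\mid j\in K\}$ (it is the free pro-$p$ group on these generators). For a profinite group $G$ let $\mathbf{Z}_p[[G]]=\varprojlim_U \mathbf{Z}_p[G/U]$, over the open normal subgroups $U$ of $G$, be its completed group ring. Let $D_k:\mathbf{Z}[F_n]\to\mathbf{Z}[F_n]$ $(1\le k\le n)$ be the Fox derivatives, i.e. the additive maps with $D_k(uv)=D_k(u)v+\varepsilon(u)D_k(v)$ and $D_k(x_j)=\delta_{jk}$, where $\varepsilon:\mathbf{Z}[F_n]\to\mathbf{Z}$ is the augmentation, and let $\partial_k:\mathbf{Z}_p[[F(n)]]\to\mathbf{Z}_p[[F(n)]]$ be the unique continuous extension of $D_k$. For a closed normal subgroup $N$ of $F(n)$ let $\pi_N:\mathbf{Z}_p[[F(n)]]\to\mathbf{Z}_p[[F(n)/N]]$ be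 the homomorphism induced by $F(n)\to F(n)/N$, and let $[N,N]$ denote the closed commutator subgroup of $N$, i.e. the closure of the subgroup generated by all commutators of elements of $N$. Let $R$ be a closed normal subgroup of $F(n)$. Then $H\cap R=1$ if and only if for every closed normal subgroup $N$ of $F(n)$ with $N\subseteq R$ and every $v\in N$, $$\bigl(\pi_N(\partial_k(v))=0\ \text{ for all } k\in\{1,\dots,n\}\setminus K\bigr)\ \Longrightarrow\ v\in[N,N].$$ -/

import Mathlib

namespace FoxProP

open Filter Topology

/-- The natural homomorphism `Γ/N → Γ/M` for `N ≤ M`. -/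
def quotMap {Γ : Type*} [Group Γ] {N M : Subgroup Γ} [N.Normal] [M.Normal] (h : N ≤ M) :
    Γ ⧸ N →* Γ ⧸ M :=
  QuotientGroup.map N M (MonoidHom.id Γ) h

/-! ## The pro-`p` completion of a discrete group and the free pro-`p` group -/

/-- The normal subgroups of `Γ` whose index is a power of `p`. -/
structure PIndexNormal (p : ℕ) (Γ : Type*) [Group Γ] where
  /-- the underlying subgroup -/
  toSubgroup : Subgroup Γ
  normal : toSubgroup.Normal
  index_eq : ∃ m : ℕ, toSubgroup.index = p ^ m

instance {p : ℕ} {Γ : Type*} [Group Γ] (N : PIndexNormal p Γ) : N.toSubgroup.Normal := N.normal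

/-- The compatible families in the product of all quotients of `Γ` of `p`-power order. -/
def proPFamilies (p : ℕ) (Γ : Type*) [Group Γ] :
    Subgroup (∀ N : PIndexNormal p Γ, Γ ⧸ N.toSubgroup) where
  carrier := {x | ∀ (N M : PIndexNormal p Γ) (h : N.toSubgroup ≤ M.toSubgroup),
    quotMap h (x N) = x M}
  mul_mem' {x y} hx hy N M h := by
    rw [Pi.mul_apply, Pi.mul_apply, map_mul, hx N M h, hy N M h]
  one_mem' N M h := by rw [Pi.one_apply, Pi.one_apply, map_one]
  inv_mem' {x} hx N M h := by rw [Pi.inv_apply, Pi.inv_apply, map_inv, hx N M h]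

/-- The pro-`p` completion of the discrete group `Γ`: the inverse limit of its quotients
of `p`-power order. -/
def ProPCompletion (p : ℕ) (Γ : Type*) [Group Γ] : Type _ := proPFamilies p Γ

namespace ProPCompletion

variable (p : ℕ) (Γ : Type*) [Group Γ]

instance : Group (ProPCompletion p Γ) := inferInstanceAs (Group (proPFamilies p Γ))

/-- The inverse limit topology, each finite quotient being discrete. -/
instance : TopologicalSpace (ProPCompletion p Γ) :=
  letI : ∀ N : PIndexNormal p Γ, TopologicalSpace (Γ ⧸ N.toSubgroup) := fun _ => ⊥
  inferInstanceAs (TopologicalSpace (proPFamilies p Γ))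

instance : IsTopologicalGroup (ProPCompletion p Γ) := by
  let _ : ∀ N : PIndexNormal p Γ, TopologicalSpace (Γ ⧸ N.toSubgroup) := fun _ => ⊥
  have : ∀ N : PIndexNormal p Γ, DiscreteTopology (Γ ⧸ N.toSubgroup) := fun _ => ⟨rfl⟩
  exact inferInstanceAs (IsTopologicalGroup (proPFamilies p Γ))

/-- The projection onto a quotient of `p`-power order. -/
def proj (N : PIndexNormal p Γ) : ProPCompletion p Γ →* Γ ⧸ N.toSubgroup :=
  (Pi.evalMonoidHom _ N).comp (proPFamilies p Γ).subtype

/-- The canonical homomorphism from `Γ` to its pro-`p` completion. -/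
def of : Γ →* ProPCompletion p Γ where
  toFun g := ⟨fun N => QuotientGroup.mk' N.toSubgroup g, fun _ _ _ => rfl⟩
  map_one' := rfl
  map_mul' _ _ := rfl

variable {p Γ}

theorem proj_of (N : PIndexNormal p Γ) (g : Γ) : proj p Γ N (of p Γ g) = (g : Γ ⧸ N.toSubgroup) :=
  rfl

theorem map_proj (x : ProPCompletion p Γ) (N M : PIndexNormal p Γ)
    (h : N.toSubgroup ≤ M.toSubgroup) :
    quotMap h (proj p Γ N x) = proj p Γ M x :=
  x.2 N M h

theorem finite_quotient [hp : Fact p.Prime] (N : PIndexNormal p Γ) : Finite (Γ ⧸ N.toSubgroup) := by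
  obtain ⟨m, hm⟩ := N.index_eq
  have : N.toSubgroup.index ≠ 0 := by rw [hm]; exact pow_ne_zero _ hp.out.ne_zero
  have : N.toSubgroup.FiniteIndex := ⟨this⟩
  infer_instance

instance [Fact p.Prime] : CompactSpace (ProPCompletion p Γ) := by
  let _ : ∀ N : PIndexNormal p Γ, TopologicalSpace (Γ ⧸ N.toSubgroup) := fun _ => ⊥
  have : ∀ N : PIndexNormal p Γ, DiscreteTopology (Γ ⧸ N.toSubgroup) := fun _ => ⟨rfl⟩
  have : ∀ N : PIndexNormal p Γ, Finite (Γ ⧸ N.toSubgroup) := finite_quotient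
  have hc : IsClosed (proPFamilies p Γ : Set (∀ N : PIndexNormal p Γ, Γ ⧸ N.toSubgroup)) := by
    have : (proPFamilies p Γ : Set (∀ N : PIndexNormal p Γ, Γ ⧸ N.toSubgroup)) =
        ⋂ (N : PIndexNormal p Γ) (M : PIndexNormal p Γ) (h : N.toSubgroup ≤ M.toSubgroup),
          {x | quotMap h (x N) = x M} := by
      ext x
      simp only [Set.mem_iInter]
      rfl
    rw [this]
    refine isClosed_iInter fun N => isClosed_iInter fun M => isClosed_iInter fun h => ?_
    exact isClosed_eq (continuous_of_discreteTopology.comp (continuous_apply N))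
      (continuous_apply M)
  exact isCompact_iff_compactSpace.mp hc.isCompact

/-- A normal subgroup of finite index whose quotient is a `p`-group has `p`-power index. -/
theorem exists_index_eq [Fact p.Prime] (N : Subgroup Γ) [N.Normal] [Finite (Γ ⧸ N)]
    (h : ∀ g : Γ, ∃ k : ℕ, g ^ p ^ k ∈ N) : ∃ m : ℕ, N.index = p ^ m := by
  have : IsPGroup p (Γ ⧸ N) := by
    intro x
    induction x using QuotientGroup.induction_on with
    | H g =>
      obtain ⟨k, hk⟩ := h g
      exact ⟨k, by rw [← QuotientGroup.mk_pow]; exact (QuotientGroup.eq_one_iff _).2 hk⟩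
  obtain ⟨m, hm⟩ := IsPGroup.iff_card.1 this
  exact ⟨m, hm⟩

theorem pow_index_mem (N : PIndexNormal p Γ) : ∃ k : ℕ, ∀ g : Γ, g ^ p ^ k ∈ N.toSubgroup := by
  obtain ⟨m, hm⟩ := N.index_eq
  exact ⟨m, fun g => hm ▸ N.toSubgroup.pow_index_mem g⟩

/-- The kernels of the projections form a basis of neighbourhoods of the identity. -/
theorem exists_ker_proj_subset [hp : Fact p.Prime] {U : Set (ProPCompletion p Γ)} (hU : U ∈ 𝓝 1) :
    ∃ N : PIndexNormal p Γ, ∀ x, proj p Γ N x = 1 → x ∈ U := by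
  classical
  let _ : ∀ N : PIndexNormal p Γ, TopologicalSpace (Γ ⧸ N.toSubgroup) := fun _ => ⊥
  have : ∀ N : PIndexNormal p Γ, DiscreteTopology (Γ ⧸ N.toSubgroup) := fun _ => ⟨rfl⟩
  have h1 : U ∈ comap (fun x : proPFamilies p Γ => x.1) (𝓝 1) := by
    have h2 : 𝓝 (1 : proPFamilies p Γ) = comap (fun x : proPFamilies p Γ => x.1) (𝓝 1) :=
      nhds_subtype_eq_comap
    rw [← h2]
    exact hU
  obtain ⟨V, hV, hVU⟩ := h1
  rw [nhds_pi, Filter.mem_pi] at hV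
  obtain ⟨I, hI, t, ht, htV⟩ := hV
  set N₀ : Subgroup Γ := ⨅ N ∈ hI.toFinset, N.toSubgroup with hN₀
  have hle : ∀ N ∈ I, N₀ ≤ N.toSubgroup := fun N hN =>
    iInf₂_le N (hI.mem_toFinset.2 hN)
  have : N₀.Normal := Subgroup.normal_iInf_normal fun N => Subgroup.normal_iInf_normal fun _ => N.normal
  have : N₀.FiniteIndex := Subgroup.finiteIndex_iInf' _ fun N _ => by
    obtain ⟨m, hm⟩ := N.index_eq
    exact ⟨by rw [hm]; exact pow_ne_zero _ hp.out.ne_zero⟩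
  choose k hk using fun N : PIndexNormal p Γ => pow_index_mem N
  have hidx := exists_index_eq (p := p) N₀ fun g => ⟨∑ N ∈ hI.toFinset, k N, by
    simp only [hN₀, Subgroup.mem_iInf]
    intro N hN
    rw [← Finset.add_sum_erase _ _ hN, pow_add, pow_mul]
    exact Subgroup.pow_mem _ (hk N g) _⟩
  refine ⟨⟨N₀, inferInstance, hidx⟩, fun x hx => hVU (htV fun N hN => ?_)⟩
  have h2 : proj p Γ N x = 1 := by
    rw [← map_proj x ⟨N₀, inferInstance, hidx⟩ N (hle N hN), hx, map_one]
  have h3 : x.1 N = 1 := h2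
  exact (congrArg (· ∈ t N) h3).mpr (mem_of_mem_nhds (ht N))

theorem exists_pow_mem [hp : Fact p.Prime] (U : OpenNormalSubgroup (ProPCompletion p Γ)) :
    ∃ k : ℕ, ∀ x : ProPCompletion p Γ, x ^ p ^ k ∈ U.toSubgroup := by
  obtain ⟨N, hN⟩ := exists_ker_proj_subset (U.isOpen'.mem_nhds U.one_mem')
  obtain ⟨m, hm⟩ := N.index_eq
  refine ⟨m, fun x => hN _ ?_⟩
  rw [map_pow, ← hm]
  exact pow_card_eq_one'

theorem exists_of_mul_mem [hp : Fact p.Prime] (U : OpenNormalSubgroup (ProPCompletion p Γ))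
    (x : ProPCompletion p Γ) : ∃ g : Γ, (of p Γ g : ProPCompletion p Γ ⧸ U.toSubgroup) = x := by
  obtain ⟨N, hN⟩ := exists_ker_proj_subset (U.isOpen'.mem_nhds U.one_mem')
  obtain ⟨g, hg⟩ := QuotientGroup.mk_surjective (proj p Γ N x)
  refine ⟨g, QuotientGroup.eq.2 (hN _ ?_)⟩
  rw [map_mul, map_inv, proj_of, hg, inv_mul_cancel]

/-- The open normal subgroup of the completion given by the kernel of a projection. -/
def kerProj (N : PIndexNormal p Γ) : OpenNormalSubgroup (ProPCompletion p Γ) where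
  toSubgroup := (proj p Γ N).ker
  isOpen' := by
    let _ : ∀ N : PIndexNormal p Γ, TopologicalSpace (Γ ⧸ N.toSubgroup) := fun _ => ⊥
    have : ∀ N : PIndexNormal p Γ, DiscreteTopology (Γ ⧸ N.toSubgroup) := fun _ => ⟨rfl⟩
    have : Continuous fun x : proPFamilies p Γ => x.1 N :=
      (continuous_apply N).comp continuous_subtype_val
    exact (isOpen_discrete ({1} : Set (Γ ⧸ N.toSubgroup))).preimage this
  isNormal' := MonoidHom.normal_ker _

end ProPCompletion

/-- The free pro-`p` group of rank `n`: the pro-`p` completion of the free group of rank `n`. -/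
abbrev FreeProP (p n : ℕ) : Type := ProPCompletion p (FreeGroup (Fin n))

/-- The free generators of the free pro-`p` group of rank `n`. -/
def FreeProP.gen (p : ℕ) {n : ℕ} (j : Fin n) : FreeProP p n :=
  ProPCompletion.of p (FreeGroup (Fin n)) (FreeGroup.of j)

/-- The closed subgroup `F(K)` of `F(n)` topologically generated by the `x_j` with `j ∈ K`. -/
def FreeProP.closedSubgroupOf (p : ℕ) {n : ℕ} (K : Set (Fin n)) : Subgroup (FreeProP p n) :=
  (Subgroup.closure (FreeProP.gen p '' K)).topologicalClosure

/-! ## Completed group rings -/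

section CompletedGroupRing

variable (p : ℕ) [Fact p.Prime] (G : Type*) [Group G] [TopologicalSpace G]

/-- The compatible families in the product of the group rings `ℤ_p[G/U]`, over all open normal
subgroups `U` of `G`. -/
noncomputable def completedGroupSubring :
    Subring (∀ U : OpenNormalSubgroup G, MonoidAlgebra ℤ_[p] (G ⧸ U.toSubgroup)) where
  carrier := {a | ∀ (U V : OpenNormalSubgroup G) (h : U.toSubgroup ≤ V.toSubgroup),
    MonoidAlgebra.mapDomainRingHom ℤ_[p]
      (quotMap h) (a U) = a V}
  mul_mem' {a b} ha hb U V h := by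
    rw [Pi.mul_apply, Pi.mul_apply, map_mul, ha U V h, hb U V h]
  one_mem' U V h := by rw [Pi.one_apply, Pi.one_apply, map_one]
  add_mem' {a b} ha hb U V h := by
    rw [Pi.add_apply, Pi.add_apply, map_add, ha U V h, hb U V h]
  zero_mem' U V h := by rw [Pi.zero_apply, Pi.zero_apply, map_zero]
  neg_mem' {a} ha U V h := by rw [Pi.neg_apply, Pi.neg_apply, map_neg, ha U V h]

/-- The completed group ring `ℤ_p[[G]]`: the inverse limit of the group rings `ℤ_p[G/U]` over
the open normal subgroups `U` of `G`. -/
def CompletedGroupRing : Type _ := completedGroupSubring p G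

namespace CompletedGroupRing

noncomputable instance : Ring (CompletedGroupRing p G) :=
  inferInstanceAs (Ring (completedGroupSubring p G))

variable {G}

/-- The projection `ℤ_p[[G]] → ℤ_p[G/U]`. -/
noncomputable def proj (U : OpenNormalSubgroup G) :
    CompletedGroupRing p G →+* MonoidAlgebra ℤ_[p] (G ⧸ U.toSubgroup) :=
  (Pi.evalRingHom _ U).comp (completedGroupSubring p G).subtype

variable (G) in
/-- The coefficients of all the projections of an element. -/
noncomputable def coeffs :
    CompletedGroupRing p G →+ (∀ U : OpenNormalSubgroup G, G ⧸ U.toSubgroup → ℤ_[p]) where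
  toFun a U g := (proj p U a).coeff g
  map_zero' := by ext; simp
  map_add' a b := by ext; simp

/-- The inverse limit topology, where `ℤ_p[G/U]` has the product topology of copies of `ℤ_p`. -/
noncomputable instance : TopologicalSpace (CompletedGroupRing p G) :=
  TopologicalSpace.induced (coeffs p G) inferInstance

/-- The canonical homomorphism from `G` to `ℤ_p[[G]]`. -/
noncomputable def of : G →* CompletedGroupRing p G where
  toFun g := ⟨fun U => MonoidAlgebra.of ℤ_[p] _ (g : G ⧸ U.toSubgroup), fun _ _ _ =>
    MonoidAlgebra.mapDomain_single⟩
  map_one' := Subtype.ext <| funext fun _ => map_one (MonoidAlgebra.of ℤ_[p] _)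
  map_mul' g h := Subtype.ext <| funext fun U =>
    map_mul (MonoidAlgebra.of ℤ_[p] (G ⧸ U.toSubgroup)) (g : G ⧸ U.toSubgroup) h

/-- The preimage of an open normal subgroup under a continuous homomorphism. -/
def comapOpenNormal {H : Type*} [Group H] [TopologicalSpace H] (f : G →ₜ* H)
    (V : OpenNormalSubgroup H) : OpenNormalSubgroup G where
  toSubgroup := V.toSubgroup.comap f.toMonoidHom
  isOpen' := V.isOpen'.preimage f.continuous_toFun
  isNormal' := V.isNormal'.comap f.toMonoidHom

/-- The ring homomorphism `ℤ_p[[G]] → ℤ_p[[H]]` induced by a continuous homomorphism `G → H`: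
its component at `V` is the map `ℤ_p[G/f⁻¹(V)] → ℤ_p[H/V]` induced by `f`. -/
noncomputable def map {H : Type*} [Group H] [TopologicalSpace H] (f : G →ₜ* H) :
    CompletedGroupRing p G →+* CompletedGroupRing p H :=
  RingHom.codRestrict
    (RingHom.pi fun V : OpenNormalSubgroup H =>
      (MonoidAlgebra.mapDomainRingHom ℤ_[p]
        (QuotientGroup.map (comapOpenNormal f V).toSubgroup V.toSubgroup f.toMonoidHom
          le_rfl)).comp (proj p (comapOpenNormal f V)))
    (completedGroupSubring p H) fun a V W h => by
      have h1 : (comapOpenNormal f V).toSubgroup ≤ (comapOpenNormal f W).toSubgroup :=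
        Subgroup.comap_mono h
      have h2 := a.2 _ _ h1
      change MonoidAlgebra.mapDomainRingHom ℤ_[p] _ (MonoidAlgebra.mapDomainRingHom ℤ_[p] _
        (a.1 (comapOpenNormal f V))) = MonoidAlgebra.mapDomainRingHom ℤ_[p] _
        (a.1 (comapOpenNormal f W))
      rw [← h2, ← RingHom.comp_apply, ← RingHom.comp_apply, ← MonoidAlgebra.mapDomainRingHom_comp,
        ← MonoidAlgebra.mapDomainRingHom_comp]
      congr 2
      ext g
      rfl

/-- The projection of a topological group onto its quotient, as a continuous homomorphism. -/
def quotientHom (N : Subgroup G) [N.Normal] : G →ₜ* G ⧸ N where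
  toMonoidHom := QuotientGroup.mk' N
  continuous_toFun := continuous_quot_mk

/-- The homomorphism `π_N : ℤ_p[[G]] → ℤ_p[[G/N]]` induced by `G → G/N`. -/
noncomputable def quotientMap (N : Subgroup G) [N.Normal] :
    CompletedGroupRing p G →+* CompletedGroupRing p (G ⧸ N) :=
  map p (quotientHom N)

theorem map_of {H : Type*} [Group H] [TopologicalSpace H] (f : G →ₜ* H) (g : G) :
    map p f (of p g) = of p (f g) := by
  refine Subtype.ext (funext fun V => ?_)
  change MonoidAlgebra.mapDomainRingHom ℤ_[p] (QuotientGroup.map (comapOpenNormal f V).toSubgroup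
    V.toSubgroup f.toMonoidHom le_rfl)
    (MonoidAlgebra.single (g : G ⧸ (comapOpenNormal f V).toSubgroup) (1 : ℤ_[p])) =
    MonoidAlgebra.single ((f g : H) : H ⧸ V.toSubgroup) (1 : ℤ_[p])
  exact MonoidAlgebra.mapDomain_single

variable {p}

theorem coeffs_injective : Function.Injective (coeffs p G) := fun _ _ h =>
  Subtype.ext <| funext fun U => MonoidAlgebra.ext (Finsupp.ext fun g => congrFun (congrFun h U) g)

instance : T2Space (CompletedGroupRing p G) :=
  T2Space.of_injective_continuous coeffs_injective continuous_induced_dom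

instance : IsTopologicalAddGroup (CompletedGroupRing p G) :=
  topologicalAddGroup_induced (coeffs p G)

theorem mapDomain_proj (a : CompletedGroupRing p G) (U V : OpenNormalSubgroup G)
    (h : U.toSubgroup ≤ V.toSubgroup) :
    MonoidAlgebra.mapDomainRingHom ℤ_[p]
      (quotMap h) (proj p U a) =
      proj p V a :=
  a.2 U V h

instance [IsTopologicalGroup G] [CompactSpace G] : CompactSpace (CompletedGroupRing p G) := by
  have hi : Topology.IsInducing (coeffs p G) := ⟨rfl⟩
  have hfin : ∀ U : OpenNormalSubgroup G, Finite (G ⧸ U.toSubgroup) := fun U =>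
    U.toSubgroup.quotient_finite_of_isOpen U.isOpen'
  have := fun U : OpenNormalSubgroup G => Fintype.ofFinite (G ⧸ U.toSubgroup)
  classical
  let S : Set (∀ U : OpenNormalSubgroup G, G ⧸ U.toSubgroup → ℤ_[p]) :=
    ⋂ (U : OpenNormalSubgroup G) (V : OpenNormalSubgroup G) (h : U.toSubgroup ≤ V.toSubgroup)
      (c : G ⧸ V.toSubgroup),
      {b | ∑ g : G ⧸ U.toSubgroup,
        (if quotMap h g = c
          then b U g else 0) = b V c}
  have key : ∀ (U V : OpenNormalSubgroup G) (h : U.toSubgroup ≤ V.toSubgroup)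
      (x : MonoidAlgebra ℤ_[p] (G ⧸ U.toSubgroup)) (c : G ⧸ V.toSubgroup),
      (MonoidAlgebra.mapDomainRingHom ℤ_[p]
        (quotMap h) x).coeff c =
      ∑ g : G ⧸ U.toSubgroup,
        (if quotMap h g = c
          then x.coeff g else 0) := by
    intro U V h x c
    rw [MonoidAlgebra.mapDomainRingHom_apply, MonoidAlgebra.coeff_mapDomain, Finsupp.mapDomain,
      Finsupp.sum_fintype _ _ (by simp), Finsupp.finsetSum_apply]
    simp [Finsupp.single_apply]
  have hS : IsClosed S := by
    refine isClosed_iInter fun U => isClosed_iInter fun V => isClosed_iInter fun h =>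
      isClosed_iInter fun c => isClosed_eq (continuous_finsetSum _ fun g _ => ?_) (by fun_prop)
    split_ifs <;> fun_prop
  have hr : Set.range (coeffs p G) = S := by
    ext b
    simp only [S, Set.mem_iInter, Set.mem_ofPred_eq]
    constructor
    · rintro ⟨a, rfl⟩ U V h c
      refine (key U V h (proj p U a) c).symm.trans ?_
      rw [mapDomain_proj]
      rfl
    · intro hb
      refine ⟨⟨fun U => ⟨Finsupp.equivFunOnFinite.symm (b U)⟩, fun U V h => ?_⟩, rfl⟩
      ext c
      rw [key]
      exact hb U V h c
  refine ⟨hi.isCompact_iff.2 ?_⟩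
  rw [Set.image_univ, hr]
  exact hS.isCompact

variable (p) in
/-- Reduction `ℤ_p[[G]] → (ℤ/p^m)[G/U]`. -/
noncomputable def red (U : OpenNormalSubgroup G) (m : ℕ) :
    CompletedGroupRing p G →+* MonoidAlgebra (ZMod (p ^ m)) (G ⧸ U.toSubgroup) :=
  (MonoidAlgebra.mapRingHom _ (PadicInt.toZModPow m)).comp (proj p U)

theorem red_coeff (U : OpenNormalSubgroup G) (m : ℕ) (a : CompletedGroupRing p G)
    (g : G ⧸ U.toSubgroup) :
    (red p U m a).coeff g = PadicInt.toZModPow m (coeffs p G a U g) :=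
  MonoidAlgebra.coeff_mapRingHom _ _ _

theorem red_of (U : OpenNormalSubgroup G) (m : ℕ) (g : G) :
    red p U m (of p g) = MonoidAlgebra.single (g : G ⧸ U.toSubgroup) 1 := by
  have h : proj p U (of p g) = MonoidAlgebra.single (g : G ⧸ U.toSubgroup) (1 : ℤ_[p]) := rfl
  rw [red, RingHom.comp_apply, h, MonoidAlgebra.mapRingHom_single, map_one]

theorem toZModPow_eq_iff (m : ℕ) (x y : ℤ_[p]) :
    PadicInt.toZModPow m x = PadicInt.toZModPow m y ↔ dist x y ≤ (p : ℝ) ^ (-m : ℤ) := by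
  rw [dist_eq_norm, PadicInt.norm_le_pow_iff_mem_span_pow, ← PadicInt.ker_toZModPow,
    RingHom.mem_ker, map_sub, sub_eq_zero]

theorem red_eq_of_le {U V : OpenNormalSubgroup G} (h : U.toSubgroup ≤ V.toSubgroup) {m k : ℕ}
    (hk : k ≤ m) {a b : CompletedGroupRing p G} (hab : red p U m a = red p U m b) :
    red p V k a = red p V k b := by
  have key : ∀ x, red p V k x = MonoidAlgebra.mapDomainRingHom _
      (quotMap h)
      (MonoidAlgebra.mapRingHom _ (ZMod.castHom (pow_dvd_pow p hk) (ZMod (p ^ k)))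
        (red p U m x)) := by
    intro x
    simp only [red, RingHom.comp_apply]
    rw [← mapDomain_proj x U V h]
    simp only [← RingHom.comp_apply]
    rw [← RingHom.comp_assoc, MonoidAlgebra.mapRingHom_comp_mapDomainRingHom,
      ← PadicInt.zmod_cast_comp_toZModPow _ _ hk, MonoidAlgebra.mapRingHom_comp]
    rfl
  rw [key, key, hab]

theorem exists_openNormal_le [IsTopologicalGroup G] (I : Finset (OpenNormalSubgroup G)) :
    ∃ W : OpenNormalSubgroup G, ∀ U ∈ I, W.toSubgroup ≤ U.toSubgroup := by
  classical
  induction I using Finset.induction_on with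
  | empty => exact ⟨⟨⊤, (inferInstance : (⊤ : Subgroup G).Normal)⟩, by simp⟩
  | insert U s _ ih =>
    obtain ⟨W, hW⟩ := ih
    refine ⟨W ⊓ U, fun U' hU' => ?_⟩
    rcases Finset.mem_insert.1 hU' with rfl | h
    · exact inf_le_right (a := W.toSubgroup)
    · exact le_trans (inf_le_left (a := W.toSubgroup)) (hW _ h)

/-- The fibres of the reductions form bases of neighbourhoods. -/
theorem mem_nhds_iff [IsTopologicalGroup G] [CompactSpace G] (a : CompletedGroupRing p G)
    {S : Set (CompletedGroupRing p G)} :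
    S ∈ 𝓝 a ↔ ∃ (U : OpenNormalSubgroup G) (m : ℕ), ∀ b, red p U m b = red p U m a → b ∈ S := by
  have hp1 : (1 : ℝ) < p := by exact_mod_cast (Fact.out : p.Prime).one_lt
  have hp0 : (0 : ℝ) < p := by linarith
  have hfin : ∀ U : OpenNormalSubgroup G, Finite (G ⧸ U.toSubgroup) := fun U =>
    U.toSubgroup.quotient_finite_of_isOpen U.isOpen'
  constructor
  · intro h
    rw [nhds_induced, nhds_pi] at h
    obtain ⟨T, hT, hTS⟩ := h
    rw [Filter.mem_pi] at hT
    obtain ⟨I, hI, t, ht, htT⟩ := hT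
    have h1 : ∀ U : OpenNormalSubgroup G, ∃ m : ℕ, ∀ b : G ⧸ U.toSubgroup → ℤ_[p],
        (∀ g, PadicInt.toZModPow m (b g) = PadicInt.toZModPow m (coeffs p G a U g)) → b ∈ t U := by
      intro U
      have := Fintype.ofFinite (G ⧸ U.toSubgroup)
      obtain ⟨ε, hε, hb⟩ := Metric.mem_nhds_iff.1 (ht U)
      obtain ⟨m, hm⟩ := exists_pow_lt_of_lt_one hε (inv_lt_one_of_one_lt₀ hp1)
      refine ⟨m, fun b hbm => hb ?_⟩
      rw [Metric.mem_ball, dist_pi_lt_iff hε]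
      intro g
      refine lt_of_le_of_lt ((toZModPow_eq_iff m _ _).1 (hbm g)) ?_
      simpa using hm
    choose m hm using h1
    obtain ⟨W, hW⟩ := exists_openNormal_le hI.toFinset
    refine ⟨W, ∑ U ∈ hI.toFinset, m U, fun b hb => hTS (htT fun U hU => hm U _ fun g => ?_)⟩
    have hU' := hI.mem_toFinset.2 hU
    have h3 := red_eq_of_le (hW U hU') (Finset.single_le_sum (fun _ _ => Nat.zero_le _) hU') hb
    rw [← red_coeff, ← red_coeff, h3]
  · rintro ⟨U, m, h⟩
    have hc : ∀ g, Continuous fun b : CompletedGroupRing p G => coeffs p G b U g := fun g =>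
      (continuous_apply g).comp ((continuous_apply U).comp continuous_induced_dom)
    have h1 : ∀ᶠ b in 𝓝 a, ∀ g, dist (coeffs p G b U g) (coeffs p G a U g) < (p : ℝ) ^ (-m : ℤ) := by
      rw [eventually_all]
      exact fun g => (hc g).continuousAt.eventually (Metric.ball_mem_nhds _ (zpow_pos hp0 _))
    filter_upwards [h1] with b hb
    refine h b (MonoidAlgebra.ext (Finsupp.ext fun g => ?_))
    rw [red_coeff, red_coeff]
    exact (toZModPow_eq_iff m _ _).2 (hb g).le

end CompletedGroupRing

end CompletedGroupRing

/-! ## Fox derivatives of the integral group ring of a free group -/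

section DiscreteFox

variable {n : ℕ}

/-- The matrix with rows `(1, δ_jk)` and `(0, x_j)`. -/
noncomputable def foxGenerator (k j : Fin n) :
    (Matrix (Fin 2) (Fin 2) (MonoidAlgebra ℤ (FreeGroup (Fin n))))ˣ where
  val := !![1, if j = k then 1 else 0; 0, MonoidAlgebra.single (FreeGroup.of j) 1]
  inv := !![1, if j = k then -MonoidAlgebra.single (FreeGroup.of j)⁻¹ 1 else 0;
    0, MonoidAlgebra.single (FreeGroup.of j)⁻¹ 1]
  val_inv := by
    rw [Matrix.mul_fin_two, Matrix.one_fin_two]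
    split_ifs <;> simp [MonoidAlgebra.single_mul_single, MonoidAlgebra.one_def]
  inv_val := by
    rw [Matrix.mul_fin_two, Matrix.one_fin_two]
    split_ifs <;> simp [MonoidAlgebra.single_mul_single, MonoidAlgebra.one_def]

/-- The group homomorphism sending `x_j` to the matrix with rows `(1, δ_jk)` and `(0, x_j)`. -/
noncomputable def foxHom (k : Fin n) : FreeGroup (Fin n) →*
    (Matrix (Fin 2) (Fin 2) (MonoidAlgebra ℤ (FreeGroup (Fin n))))ˣ :=
  FreeGroup.lift (foxGenerator k)

/-- The linear extension of `foxHom` to the group ring. -/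
noncomputable def foxMatrix (k : Fin n) : MonoidAlgebra ℤ (FreeGroup (Fin n)) →ₐ[ℤ]
    Matrix (Fin 2) (Fin 2) (MonoidAlgebra ℤ (FreeGroup (Fin n))) :=
  MonoidAlgebra.lift ℤ _ _ ((Units.coeHom _).comp (foxHom k))

/-- The Fox derivative `D_k` of the group ring `ℤ[F_n]`: the upper right entry of `foxMatrix`.
See `discreteFox_mul` and `discreteFox_gen` for its defining properties
`D_k(uv) = D_k(u)v + ε(u)D_k(v)` and `D_k(x_j) = δ_jk`. -/
noncomputable def discreteFox (k : Fin n) :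
    MonoidAlgebra ℤ (FreeGroup (Fin n)) →+ MonoidAlgebra ℤ (FreeGroup (Fin n)) where
  toFun u := foxMatrix k u 0 1
  map_zero' := by rw [map_zero]; rfl
  map_add' u v := by rw [map_add]; rfl

/-- The augmentation `ε : ℤ[F_n] → ℤ`. -/
noncomputable def augmentation (n : ℕ) : MonoidAlgebra ℤ (FreeGroup (Fin n)) →ₐ[ℤ] ℤ :=
  MonoidAlgebra.lift ℤ ℤ _ 1

theorem foxMatrix_single (k : Fin n) (f : FreeGroup (Fin n)) :
    foxMatrix k (MonoidAlgebra.single f 1) = (foxHom k f).val := by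
  simp [foxMatrix]

theorem foxHom_entries (k : Fin n) (f : FreeGroup (Fin n)) :
    (foxHom k f).val 0 0 = 1 ∧ (foxHom k f).val 1 0 = 0 ∧
      (foxHom k f).val 1 1 = MonoidAlgebra.single f 1 := by
  induction f using FreeGroup.induction_on with
  | C1 => simp [MonoidAlgebra.one_def]
  | of j => simp [foxHom, foxGenerator]
  | inv_of j _ =>
    rw [map_inv, foxHom, FreeGroup.lift_apply_of]
    change (foxGenerator k j).inv 0 0 = 1 ∧ (foxGenerator k j).inv 1 0 = 0 ∧
      (foxGenerator k j).inv 1 1 = _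
    simp [foxGenerator]
  | mul x y hx hy =>
    rw [map_mul, Units.val_mul]
    simp only [Matrix.mul_apply, Fin.sum_univ_two]
    rw [hx.1, hx.2.1, hx.2.2, hy.1, hy.2.1, hy.2.2]
    simp [MonoidAlgebra.single_mul_single]

theorem foxMatrix_entries (k : Fin n) (u : MonoidAlgebra ℤ (FreeGroup (Fin n))) :
    foxMatrix k u 0 0 = (augmentation n u : MonoidAlgebra ℤ (FreeGroup (Fin n))) ∧
      foxMatrix k u 1 0 = 0 ∧ foxMatrix k u 1 1 = u := by
  induction u using MonoidAlgebra.induction_on with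
  | of f =>
    rw [MonoidAlgebra.of_apply, foxMatrix_single]
    obtain ⟨h1, h2, h3⟩ := foxHom_entries k f
    exact ⟨by rw [h1]; simp [augmentation], h2, h3⟩
  | add u v hu hv =>
    simp only [map_add, Matrix.add_apply, hu, hv, Int.cast_add, add_zero, and_self]
  | smul r u hu =>
    simp only [map_smul, Matrix.smul_apply, hu]
    simp

theorem discreteFox_gen (k j : Fin n) :
    discreteFox k (MonoidAlgebra.single (FreeGroup.of j) 1) = if j = k then 1 else 0 := by
  change foxMatrix k _ 0 1 = _
  rw [foxMatrix_single]
  simp [foxHom, foxGenerator]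

theorem discreteFox_mul (k : Fin n) (u v : MonoidAlgebra ℤ (FreeGroup (Fin n))) :
    discreteFox k (u * v) = discreteFox k u * v + augmentation n u • discreteFox k v := by
  change foxMatrix k _ 0 1 = foxMatrix k _ 0 1 * v + _ • foxMatrix k _ 0 1
  rw [map_mul, Matrix.mul_apply, Fin.sum_univ_two, (foxMatrix_entries k u).1,
    (foxMatrix_entries k v).2.2, add_comm, zsmul_eq_mul]

end DiscreteFox

/-! ## Fox derivatives of the completed group ring of a free pro-`p` group -/

section CompletedFox

variable (p : ℕ) [Fact p.Prime] (n : ℕ)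

/-- The canonical homomorphism `ℤ[F_n] → ℤ_p[[F(n)]]`. -/
noncomputable def groupRingMap :
    MonoidAlgebra ℤ (FreeGroup (Fin n)) →ₐ[ℤ] CompletedGroupRing p (FreeProP p n) :=
  MonoidAlgebra.lift ℤ _ _
    ((CompletedGroupRing.of p).comp (ProPCompletion.of p (FreeGroup (Fin n))))

variable {p n}

open CompletedGroupRing

theorem red_groupRingMap_single (U : OpenNormalSubgroup (FreeProP p n)) (m : ℕ)
    (f : FreeGroup (Fin n)) (z : ℤ) :
    red p U m (groupRingMap p n (MonoidAlgebra.single f z)) =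
      MonoidAlgebra.single (ProPCompletion.of p _ f : FreeProP p n ⧸ U.toSubgroup) (z : ZMod _) := by
  rw [groupRingMap, MonoidAlgebra.lift_single, map_zsmul, MonoidHom.comp_apply, red_of]
  ext
  simp

theorem denseRange_groupRingMap : DenseRange (groupRingMap p n) := by
  intro a
  rw [mem_closure_iff_nhds]
  intro S hS
  obtain ⟨U, m, h⟩ := (mem_nhds_iff a).1 hS
  have hfin : Finite (FreeProP p n ⧸ U.toSubgroup) := U.toSubgroup.quotient_finite_of_isOpen U.isOpen'
  have := Fintype.ofFinite (FreeProP p n ⧸ U.toSubgroup)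
  have hf : ∀ c : FreeProP p n ⧸ U.toSubgroup, ∃ f : FreeGroup (Fin n),
      (ProPCompletion.of p _ f : FreeProP p n ⧸ U.toSubgroup) = c := by
    intro c
    obtain ⟨x, rfl⟩ := QuotientGroup.mk_surjective c
    exact ProPCompletion.exists_of_mul_mem U x
  choose f hf using hf
  choose z hz using fun c => ZMod.intCast_surjective ((red p U m a).coeff c)
  refine ⟨_, h _ ?_, ∑ c, MonoidAlgebra.single (f c) (z c), rfl⟩
  rw [map_sum, map_sum]
  simp only [red_groupRingMap_single, hf, hz]
  ext c
  classical
  rw [MonoidAlgebra.coeff_sum, Finsupp.finsetSum_apply]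
  simp [Finsupp.single_apply]

/-- Continuity of the Fox derivatives `D_k` in the topology induced from `ℤ_p[[F(n)]]`. -/
theorem exists_red_discreteFox (k : Fin n) (U : OpenNormalSubgroup (FreeProP p n)) (m : ℕ) :
    ∃ V : OpenNormalSubgroup (FreeProP p n), ∀ r s : MonoidAlgebra ℤ (FreeGroup (Fin n)),
      red p V m (groupRingMap p n r) = red p V m (groupRingMap p n s) →
      red p U m (groupRingMap p n (discreteFox k r)) =
        red p U m (groupRingMap p n (discreteFox k s)) := by
  have hfin : Finite (FreeProP p n ⧸ U.toSubgroup) := U.toSubgroup.quotient_finite_of_isOpen U.isOpen'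
  have hp : NeZero (p ^ m) := ⟨pow_ne_zero _ (Fact.out : p.Prime).ne_zero⟩
  set B := MonoidAlgebra (ZMod (p ^ m)) (FreeProP p n ⧸ U.toSubgroup) with hB
  have hBfin : Finite B := by
    have := Fintype.ofFinite (FreeProP p n ⧸ U.toSubgroup)
    exact Finite.of_injective (fun b : B => fun c => b.coeff c) fun a b h =>
      MonoidAlgebra.ext (Finsupp.ext fun c => congrFun h c)
  let ψ : MonoidAlgebra ℤ (FreeGroup (Fin n)) →+* B :=
    (red p U m).comp (groupRingMap p n).toRingHom
  let μ : FreeGroup (Fin n) →* (Matrix (Fin 2) (Fin 2) B)ˣ :=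
    (Units.map (ψ.mapMatrix (m := Fin 2)).toMonoidHom).comp (foxHom k)
  have hμ : ∀ f, (μ f).val = ψ.mapMatrix (foxHom k f).val := fun _ => rfl
  have hμf : ∀ f, (μ f).val = !![1, (μ f).val 0 1; 0,
      MonoidAlgebra.single (ProPCompletion.of p _ f : FreeProP p n ⧸ U.toSubgroup) 1] := by
    intro f
    obtain ⟨h1, h2, h3⟩ := foxHom_entries k f
    refine Matrix.ext fun i j => ?_
    fin_cases i <;> fin_cases j
    · simp [hμ, h1]
    · rfl
    · simp [hμ, h2]
    · have := red_groupRingMap_single U m f 1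
      simp only [Int.cast_one] at this
      rw [hμ, RingHom.mapMatrix_apply, Matrix.map_apply]
      change ψ ((foxHom k f).val 1 1) = MonoidAlgebra.single _ 1
      rw [h3]
      exact this
  have hfinW : Finite (FreeGroup (Fin n) ⧸ μ.ker) :=
    Finite.of_injective _ (QuotientGroup.kerLift_injective μ)
  obtain ⟨t, ht⟩ := ProPCompletion.exists_pow_mem U
  have hunip : ∀ (b : B) (i : ℕ), (!![1, b; 0, 1] : Matrix (Fin 2) (Fin 2) B) ^ i =
      !![1, i • b; 0, 1] := by
    intro b i
    induction i with
    | zero => simp [Matrix.one_fin_two]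
    | succ i ih => rw [pow_succ, ih, Matrix.mul_fin_two]; simp [add_mul, add_comm]
  have hidx := ProPCompletion.exists_index_eq (p := p) μ.ker fun f => ⟨t + m, by
    rw [MonoidHom.mem_ker, pow_add, pow_mul, map_pow]
    ext1
    have h1 : (ProPCompletion.of p _ (f ^ p ^ t) : FreeProP p n ⧸ U.toSubgroup) = 1 := by
      rw [map_pow]
      exact (QuotientGroup.eq_one_iff _).2 (ht _)
    rw [Units.val_pow_eq_pow_val, hμf, h1, ← MonoidAlgebra.one_def, hunip]
    have h2 : ∀ b : B, (p ^ m) • b = 0 := by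
      intro b
      rw [← Nat.cast_smul_eq_nsmul (ZMod (p ^ m)), ZMod.natCast_self, zero_smul]
    rw [h2, Units.val_one, Matrix.one_fin_two]⟩
  let W : PIndexNormal p (FreeGroup (Fin n)) := ⟨μ.ker, inferInstance, hidx⟩
  let V := ProPCompletion.kerProj W
  let θ : FreeProP p n ⧸ V.toSubgroup →* (Matrix (Fin 2) (Fin 2) B)ˣ :=
    QuotientGroup.lift V.toSubgroup
      ((QuotientGroup.kerLift μ).comp (ProPCompletion.proj p _ W)) fun x hx => by
        have h1 : ProPCompletion.proj p _ W x = 1 := hx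
        rw [MonoidHom.mem_ker, MonoidHom.comp_apply, h1]
        exact map_one (QuotientGroup.kerLift μ)
  have hθ : ∀ f, θ (ProPCompletion.of p _ f : FreeProP p n) = μ f := fun _ => rfl
  let Θ : MonoidAlgebra (ZMod (p ^ m)) (FreeProP p n ⧸ V.toSubgroup) →+*
      Matrix (Fin 2) (Fin 2) B :=
    (MonoidAlgebra.lift (ZMod (p ^ m)) _ _ ((Units.coeHom _).comp θ) : _ →ₐ[_] _)
  have key : (Θ.comp (red p V m)).comp (groupRingMap p n).toRingHom =
      (ψ.mapMatrix (m := Fin 2)).comp (foxMatrix k).toRingHom := by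
    refine MonoidAlgebra.ringHom_ext (fun z => ?_) fun f => ?_
    · have h1 : (MonoidAlgebra.single 1 z : MonoidAlgebra ℤ (FreeGroup (Fin n))) = (z : ℤ) := by
        rw [MonoidAlgebra.intCast_def]
        simp
      rw [h1, map_intCast, map_intCast]
    · change Θ (red p V m (groupRingMap p n (MonoidAlgebra.single f 1))) =
        ψ.mapMatrix (foxMatrix k (MonoidAlgebra.single f 1))
      rw [red_groupRingMap_single, foxMatrix_single, ← hμ, ← hθ]
      simp [Θ]
  refine ⟨V, fun r s hrs => ?_⟩
  have h1 : ∀ r, red p U m (groupRingMap p n (discreteFox k r)) =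
      Θ (red p V m (groupRingMap p n r)) 0 1 := fun r =>
    (congrFun (congrFun (RingHom.congr_fun key r) 0) 1).symm
  rw [h1, h1, hrs]

variable (p) in
/-- The Fox derivative `D_k` has a unique continuous extension to `ℤ_p[[F(n)]]`. -/
theorem existsUnique_foxDerivative (k : Fin n) :
    ∃! D : C(CompletedGroupRing p (FreeProP p n), CompletedGroupRing p (FreeProP p n)),
      ∀ u, D (groupRingMap p n u) = groupRingMap p n (discreteFox k u) := by
  let _ : TopologicalSpace (MonoidAlgebra ℤ (FreeGroup (Fin n))) :=
    TopologicalSpace.induced (groupRingMap p n) inferInstance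
  have di : IsDenseInducing (groupRingMap p n) := ⟨⟨rfl⟩, denseRange_groupRingMap⟩
  have hlim : ∀ a, ∃ c, Tendsto (fun u => groupRingMap p n (discreteFox k u))
      (comap (groupRingMap p n) (𝓝 a)) (𝓝 c) := by
    intro a
    have := di.comap_nhds_neBot a
    obtain ⟨c, hc⟩ := exists_clusterPt_of_compactSpace
      (map (fun u => groupRingMap p n (discreteFox k u)) (comap (groupRingMap p n) (𝓝 a)))
    refine ⟨c, fun S hS => ?_⟩
    obtain ⟨U, m, hU⟩ := (mem_nhds_iff c).1 hS
    obtain ⟨V, hV⟩ := exists_red_discreteFox k U m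
    have h1 : {u | red p V m (groupRingMap p n u) = red p V m a} ∈
        comap (groupRingMap p n) (𝓝 a) :=
      preimage_mem_comap ((mem_nhds_iff a).2 ⟨V, m, fun _ hb => hb⟩)
    have h2 : {b | red p U m b = red p U m c} ∈ 𝓝 c := (mem_nhds_iff c).2 ⟨U, m, fun _ hb => hb⟩
    obtain ⟨_, h3, u, h4, rfl⟩ := (clusterPt_iff_nonempty.1 hc) h2 (image_mem_map h1)
    refine mem_map.2 (mem_of_superset h1 fun v hv => hU _ ?_)
    rw [← show red p U m (groupRingMap p n (discreteFox k u)) = red p U m c from h3]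
    exact hV _ _ (Eq.trans hv (Eq.symm h4))
  refine ⟨⟨di.extend fun u => groupRingMap p n (discreteFox k u), di.continuous_extend hlim⟩,
    fun u => ?_, fun D hD => ?_⟩
  · obtain ⟨c, hc⟩ := hlim (groupRingMap p n u)
    rw [← di.nhds_eq_comap] at hc
    exact di.extend_eq_at' c hc
  · ext1 a
    exact (di.extend_unique hD D.continuous ▸ rfl)

variable (p) in
/-- The Fox derivative `∂_k` of `ℤ_p[[F(n)]]`: the continuous extension of `D_k`. -/
noncomputable def foxDerivative (k : Fin n) :
    C(CompletedGroupRing p (FreeProP p n), CompletedGroupRing p (FreeProP p n)) :=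
  (existsUnique_foxDerivative p k).choose

theorem foxDerivative_groupRingMap (k : Fin n) (u : MonoidAlgebra ℤ (FreeGroup (Fin n))) :
    foxDerivative p k (groupRingMap p n u) = groupRingMap p n (discreteFox k u) :=
  (existsUnique_foxDerivative p k).choose_spec.1 u

end CompletedFox

end FoxProP

/-! Write F for F(n) and H for F(K).

If the implication holds for all N, descend. Each derivative with index outside K kills H, so an
element of H ∩ R meets the condition for N = R, then for N the closure of [R,R], and so on along the
closed derived series of R. That series has trivial intersection, because finite p-groups are
solvable.

Conversely, H ∩ R = 1 gives H ∩ N = 1, and it suffices to show v ∈ [N,N]W for every open normal W.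
By compactness there is an open normal V containing N with H ∩ V ≤ W and with the same image M as N
in F/W. Since H ∩ V ≤ W, coset representatives s : F/V → F/W can be chosen that commute with left
multiplication by H (`exists_equivariant_representatives`). The elements s(wg)⁻¹ w s(g) lie in M.
Their classes c_w(g) in the abelianization of M satisfy c_{vw}(g) = c_v(wg) + c_w(g), which is the
product rule of Fox calculus. Hence c_w is a sum over k in which the k-th term depends only on
c_{x_k} and on the image of D_k(w) in (ℤ/p^m)[F/V], where p^m kills the abelianization
(`sectionCocycle_eq_sum_translateSum`). For k ∈ K the term vanishes because s is equivariant; for k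
∉ K it vanishes by hypothesis on v, once w is a close approximation of v. At g = 1 this says that
s(1)⁻¹ v s(1) is trivial in the abelianization of M, so v ∈ [N,N]W
(`mem_commutator_sup_of_foxDerivative_eq_zero`). -/

namespace FoxProP

open Filter Topology CompletedGroupRing

/-! ### Fox calculus for the cocycle of a section -/

section Cocycle

variable {n q : ℕ} {G E A : Type*} [Group G] [Group E] [AddCommGroup A] [Module (ZMod q) A]

/-- The value `χ(s(wg)⁻¹ w s(g))` measuring the failure of equivariance of `s : G → E`. -/
def sectionCocycle {Γ : Type*} [Group Γ] (α : Γ →* G) (β : Γ →* E) {M : Subgroup E}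
    (χ : M →* Multiplicative A) (s : G → E) (hs : ∀ w g, (s (α w * g))⁻¹ * β w * s g ∈ M)
    (w : Γ) (g : G) : A :=
  (χ ⟨(s (α w * g))⁻¹ * β w * s g, hs w g⟩).toAdd

/-- Inserting s(wg) s(wg)⁻¹ splits s(vwg)⁻¹ vw s(g) into two factors of M, and χ turns the product
into a sum. -/
theorem sectionCocycle_mul {Γ : Type*} [Group Γ] (α : Γ →* G) (β : Γ →* E) {M : Subgroup E}
    (χ : M →* Multiplicative A) (s : G → E) (hs : ∀ w g, (s (α w * g))⁻¹ * β w * s g ∈ M)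
    (v w : Γ) (g : G) :
    sectionCocycle α β χ s hs (v * w) g =
      sectionCocycle α β χ s hs v (α w * g) + sectionCocycle α β χ s hs w g := by
  rw [sectionCocycle, sectionCocycle, sectionCocycle, ← toAdd_mul, ← map_mul]
  congr 2
  ext
  simp [mul_assoc]

/-- The linear map on the group ring of `G` sending `y` to `c (y * g)`. -/
noncomputable def translateSum (q : ℕ) [Module (ZMod q) A] (c : G → A) (g : G) :
    MonoidAlgebra (ZMod q) G →+ A :=
  (Finsupp.linearCombination (ZMod q) fun y => c (y * g)).toAddMonoidHom.comp
    MonoidAlgebra.coeffAddEquiv.toAddMonoidHom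

theorem translateSum_single (c : G → A) (g y : G) (z : ZMod q) :
    translateSum q c g (MonoidAlgebra.single y z) = z • c (y * g) := by
  change Finsupp.linearCombination (ZMod q) (fun y => c (y * g)) (Finsupp.single y z) = _
  rw [Finsupp.linearCombination_single]

/-- Right multiplication by y becomes a shift of the base point. This matches the factor v in
D_k(u)v with the argument wg in the cocycle rule. -/
theorem translateSum_mul_single (c : G → A) (g y : G) (b : MonoidAlgebra (ZMod q) G) :
    translateSum q c g (b * MonoidAlgebra.single y 1) = translateSum q c (y * g) b := by
  induction b using MonoidAlgebra.induction_linear with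
  | zero => simp
  | add b b' hb hb' => rw [add_mul, map_add, map_add, hb, hb']
  | single x z =>
    rw [MonoidAlgebra.single_mul_single, translateSum_single, translateSum_single, mul_one,
      mul_assoc]

theorem discreteFox_single_mul (k : Fin n) (v w : FreeGroup (Fin n)) :
    discreteFox k (MonoidAlgebra.single (v * w) 1) =
      discreteFox k (MonoidAlgebra.single v 1) * MonoidAlgebra.single w 1 +
        discreteFox k (MonoidAlgebra.single w 1) := by
  have h := discreteFox_mul k (MonoidAlgebra.single v 1) (MonoidAlgebra.single w 1)
  rw [MonoidAlgebra.single_mul_single, mul_one] at h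
  rw [h]
  simp [augmentation]

theorem discreteFox_one (k : Fin n) :
    discreteFox k (MonoidAlgebra.single (1 : FreeGroup (Fin n)) 1) = 0 := by
  have h := discreteFox_single_mul k (1 : FreeGroup (Fin n)) 1
  rw [mul_one, ← MonoidAlgebra.one_def, mul_one] at h
  rw [← MonoidAlgebra.one_def]
  exact left_eq_add.1 h

/-- The cocycle of a section is determined by the images of the Fox derivatives in the group
ring of `G` and by its values on the generators. -/
theorem sectionCocycle_eq_sum_translateSum (α : FreeGroup (Fin n) →* G) (β : FreeGroup (Fin n) →* E)
    {M : Subgroup E} (χ : M →* Multiplicative A) (s : G → E)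
    (hs : ∀ w g, (s (α w * g))⁻¹ * β w * s g ∈ M)
    (ρ : MonoidAlgebra ℤ (FreeGroup (Fin n)) →+* MonoidAlgebra (ZMod q) G)
    (hρ : ∀ w, ρ (MonoidAlgebra.single w 1) = MonoidAlgebra.single (α w) 1)
    (w : FreeGroup (Fin n)) (g : G) :
    sectionCocycle α β χ s hs w g =
      ∑ k, translateSum q (sectionCocycle α β χ s hs (FreeGroup.of k)) g
        (ρ (discreteFox k (MonoidAlgebra.single w 1))) := by
  set c := sectionCocycle α β χ s hs with hc
  set D : FreeGroup (Fin n) → G → A := fun w g =>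
    ∑ k, translateSum q (c (FreeGroup.of k)) g (ρ (discreteFox k (MonoidAlgebra.single w 1)))
    with hD
  have hcmul : ∀ v w g, c (v * w) g = c v (α w * g) + c w g := sectionCocycle_mul α β χ s hs
  -- Both sides obey the same product rule, so it is enough to compare them on the generators.
  have hDmul : ∀ v w g, D (v * w) g = D v (α w * g) + D w g := fun v w g => by
    simp only [hD, ← Finset.sum_add_distrib]
    refine Finset.sum_congr rfl fun k _ => ?_
    rw [discreteFox_single_mul, map_add, map_mul, hρ, map_add, translateSum_mul_single]
  have hc1 : ∀ g, c 1 g = 0 := fun g => by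
    have h := hcmul 1 1 g
    rw [mul_one, map_one, one_mul] at h
    exact left_eq_add.1 h
  have hD1 : ∀ g, D 1 g = 0 := fun g => by simp [hD, discreteFox_one]
  change c w g = D w g
  induction w using FreeGroup.induction_on generalizing g with
  | C1 => rw [hc1, hD1]
  | of j =>
    simp only [hD, discreteFox_gen]
    rw [Finset.sum_eq_single j]
    · rw [if_pos rfl, map_one, MonoidAlgebra.one_def, translateSum_single, one_smul, one_mul]
    · intro k _ hk
      rw [if_neg hk.symm, map_zero, map_zero]
    · simp
  -- The rule for x_j x_j⁻¹ = 1 determines the value at x_j⁻¹; `ih` is needed at the translated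
  -- point α(x_j⁻¹)g.
  | inv_of j ih =>
    have h1 := hcmul (FreeGroup.of j) (FreeGroup.of j)⁻¹ g
    have h2 := hDmul (FreeGroup.of j) (FreeGroup.of j)⁻¹ g
    rw [mul_inv_cancel, hc1] at h1
    rw [mul_inv_cancel, hD1, ← ih] at h2
    exact add_left_cancel (h1.symm.trans h2)
  | mul v w hv hw => rw [hcmul, hDmul, hv, hw]

end Cocycle

/-- If `H ∩ V ≤ W`, there is an `H`-equivariant choice of representatives modulo `W` of the
cosets of `V`. -/
theorem exists_equivariant_representatives {F : Type*} [Group F] (H V W : Subgroup F) [V.Normal]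
    [W.Normal] (h : H ⊓ V ≤ W) :
    ∃ s : F ⧸ V → F ⧸ W, (∀ x ∈ H, ∀ g, s ((x : F ⧸ V) * g) = (x : F ⧸ W) * s g) ∧
      ∀ t : F, ∃ v ∈ V, s t = (t * v : F) := by
  -- One representative is fixed in each double coset HtV. In t = x r v the factor x ∈ H is unique
  -- up to H ∩ rVr⁻¹ = H ∩ V ≤ W, so x r is well defined modulo W.
  let r : F → F := fun t => (DoubleCoset.mk H V t).out
  have hr : ∀ t, ∃ x ∈ H, ∃ v ∈ V, t = x * r t * v := fun t => by
    have h1 : DoubleCoset.mk H V (r t) = DoubleCoset.mk H V t := Quotient.out_eq' _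
    obtain ⟨x, hx, v, hv, h2⟩ := (DoubleCoset.eq H V _ _).1 h1
    exact ⟨x, hx, v, hv, h2⟩
  choose x hx v hv hxv using hr
  have hmk : ∀ y ∈ H, ∀ w ∈ V, ∀ t, r (y * t * w) = r t := fun y hy w hw t =>
    congrArg Quotient.out ((DoubleCoset.eq H V _ _).2 ⟨y, hy, w, hw, rfl⟩).symm
  let s : F → F ⧸ W := fun t => (x t * r t : F)
  have hs : ∀ y ∈ H, ∀ w ∈ V, ∀ t, s (y * t * w) = (y : F ⧸ W) * s t := by
    intro y hy w hw t
    have h1 := hxv (y * t * w)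
    have h2 := hxv t
    simp only [s]
    rw [hmk y hy w hw] at h1 ⊢
    -- Two H-components relative to the same r differ by an element of rVr⁻¹ = V; they also differ
    -- by an element of H, hence by one of W.
    have h3 : (y * x t)⁻¹ * x (y * t * w) ∈ V := by
      have h4 : (y * x t)⁻¹ * x (y * t * w) =
          r t * (v t * w * (v (y * t * w))⁻¹) * (r t)⁻¹ := by
        have h5 : x (y * t * w) = y * t * w * (v (y * t * w))⁻¹ * (r t)⁻¹ := by
          rw [eq_mul_inv_iff_mul_eq, eq_mul_inv_iff_mul_eq]
          exact h1.symm
        have h6 : (x t)⁻¹ * t = r t * v t := by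
          rw [inv_mul_eq_iff_eq_mul, ← mul_assoc]; exact h2
        rw [h5]
        calc _ = (x t)⁻¹ * t * (w * (v (y * t * w))⁻¹ * (r t)⁻¹) := by group
          _ = _ := by rw [h6]; group
      rw [h4]
      exact Subgroup.Normal.conj_mem inferInstance _
        (V.mul_mem (V.mul_mem (hv _) hw) (V.inv_mem (hv _))) _
    have h4 : (y * x t)⁻¹ * x (y * t * w) ∈ W :=
      h ⟨H.mul_mem (H.inv_mem (H.mul_mem hy (hx _))) (hx _), h3⟩
    rw [← QuotientGroup.mk_mul, ← mul_assoc, QuotientGroup.mk_mul, QuotientGroup.mk_mul (N := W) (y * x t),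
      (QuotientGroup.eq.2 h4)]
  -- Right invariance of s under V makes the choice of `g.out` immaterial.
  refine ⟨fun g => s g.out, fun y hy g => ?_, fun t => ?_⟩
  · induction g using QuotientGroup.induction_on with
    | H t =>
      obtain ⟨a, ha⟩ := QuotientGroup.mk_out_eq_mul V t
      obtain ⟨b, hb⟩ := QuotientGroup.mk_out_eq_mul V (y * t)
      have h1 := hs y hy b b.2 t
      have h2 := hs 1 H.one_mem a a.2 t
      rw [one_mul, QuotientGroup.mk_one, one_mul] at h2
      simp only [← QuotientGroup.mk_mul]
      rw [ha, hb, h1, h2]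
  · obtain ⟨a, ha⟩ := QuotientGroup.mk_out_eq_mul V t
    refine ⟨(v t)⁻¹, V.inv_mem (hv t), ?_⟩
    have h2 := hs 1 H.one_mem a a.2 t
    rw [one_mul, QuotientGroup.mk_one, one_mul] at h2
    simp only
    rw [ha, h2]
    simp only [s]
    congr 1
    rw [eq_mul_inv_iff_mul_eq]
    exact (hxv t).symm

/-! ### Reductions, continuity, and derivatives on F(K) -/

section Topological

variable {p : ℕ} [Fact p.Prime]

/-- Since N ≤ V, the quotient G/V is also a quotient of G/N, so reduction to (ℤ/p^m)[G/V] factors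
through `quotientMap p N`. -/
theorem red_eq_zero_of_quotientMap_eq_zero {G : Type*} [Group G] [TopologicalSpace G]
    [IsTopologicalGroup G] (N : Subgroup G) [N.Normal] (V : OpenNormalSubgroup G)
    (h : N ≤ V.toSubgroup) (m : ℕ) {a : CompletedGroupRing p G} (ha : quotientMap p N a = 0) :
    red p V m a = 0 := by
  let V' : OpenNormalSubgroup (G ⧸ N) :=
    { toSubgroup := V.toSubgroup.map (QuotientGroup.mk' N)
      isOpen' := QuotientGroup.isOpenMap_coe _ V.isOpen'
      isNormal' := V.isNormal'.map _ (QuotientGroup.mk'_surjective N) }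
  let C := comapOpenNormal (quotientHom N) V'
  have hC : C.toSubgroup ≤ V.toSubgroup := by
    change (V.toSubgroup.map (QuotientGroup.mk' N)).comap (QuotientGroup.mk' N) ≤ _
    rw [Subgroup.comap_map_eq, QuotientGroup.ker_mk', sup_eq_left.2 h]
  have h1 : MonoidAlgebra.mapDomainRingHom ℤ_[p] (QuotientGroup.map C.toSubgroup V'.toSubgroup
      (quotientHom N).toMonoidHom le_rfl) (proj p C a) = 0 :=
    congrArg (proj p V') ha
  have hinj : Function.Injective (QuotientGroup.map C.toSubgroup V'.toSubgroup
      (quotientHom N).toMonoidHom le_rfl) := by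
    rw [injective_iff_map_eq_one]
    intro x hx
    induction x using QuotientGroup.induction_on with
    | H g =>
      exact (QuotientGroup.eq_one_iff _).2
        ((QuotientGroup.eq_one_iff (N := V'.toSubgroup) (g : G ⧸ N)).1 hx)
  have h2 : proj p C a = 0 := MonoidAlgebra.mapDomain_injective hinj (h1.trans (map_zero
    (MonoidAlgebra.mapDomainRingHom ℤ_[p] _)).symm)
  rw [red, RingHom.comp_apply, ← mapDomain_proj a C V hC, h2, map_zero, map_zero]

theorem continuous_of {G : Type*} [Group G] [TopologicalSpace G] [IsTopologicalGroup G]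
    [CompactSpace G] : Continuous (CompletedGroupRing.of p : G → CompletedGroupRing p G) := by
  rw [continuous_iff_continuousAt]
  intro g S hS
  obtain ⟨U, m, hU⟩ := (mem_nhds_iff _).1 hS
  have h1 : (fun x => g⁻¹ * x) ⁻¹' (U.toSubgroup : Set G) ∈ 𝓝 g :=
    (U.isOpen'.preimage (continuous_const_mul g⁻¹)).mem_nhds (by simp)
  refine mem_map.2 (mem_of_superset h1 fun x hx => hU _ ?_)
  rw [red_of, red_of, QuotientGroup.eq.2 hx]

variable {n : ℕ}

theorem groupRingMap_single (f : FreeGroup (Fin n)) :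
    groupRingMap p n (MonoidAlgebra.single f 1) =
      CompletedGroupRing.of p (ProPCompletion.of p _ f) := by
  simp [groupRingMap]

/-- The Fox derivatives with index outside `K` vanish on `F(K)`. -/
theorem foxDerivative_of_eq_zero (K : Set (Fin n)) {k : Fin n} (hk : k ∉ K) {v : FreeProP p n}
    (hv : v ∈ FreeProP.closedSubgroupOf p K) :
    foxDerivative p k (CompletedGroupRing.of p v) = 0 := by
  -- The vanishing locus is closed, so only words in the x_j with j ∈ K need to be checked.
  have hclosed : IsClosed {v : FreeProP p n | foxDerivative p k (CompletedGroupRing.of p v) = 0} :=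
    isClosed_eq ((foxDerivative p k).continuous.comp continuous_of) continuous_const
  refine closure_minimal (fun x hx => ?_) hclosed hv
  have h1 : FreeProP.gen p '' K = ProPCompletion.of p (FreeGroup (Fin n)) '' (FreeGroup.of '' K) := by
    rw [Set.image_image]
    rfl
  rw [h1, ← MonoidHom.map_closure] at hx
  obtain ⟨f, hf, rfl⟩ := hx
  change foxDerivative p k _ = 0
  rw [← groupRingMap_single, foxDerivative_groupRingMap]
  suffices discreteFox k (MonoidAlgebra.single f 1) = 0 by rw [this, map_zero]
  induction hf using Subgroup.closure_induction with
  | mem x hx =>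
    obtain ⟨j, hj, rfl⟩ := hx
    rw [discreteFox_gen, if_neg]
    rintro rfl
    exact hk hj
  | one => exact discreteFox_one k
  | mul x y _ _ hx hy => rw [discreteFox_single_mul, hx, hy, zero_mul, add_zero]
  | inv x _ hx =>
    have h := discreteFox_single_mul k x x⁻¹
    rw [mul_inv_cancel, discreteFox_one, hx, zero_mul, zero_add] at h
    exact h.symm

end Topological

/-! ### Approximation and the argument in a finite quotient -/

section Main

variable {p : ℕ} [Fact p.Prime] {n : ℕ}

theorem exists_openNormal_le_of_mem_nhds {U : Set (FreeProP p n)} (hU : U ∈ 𝓝 1) :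
    ∃ W : OpenNormalSubgroup (FreeProP p n), (W.toSubgroup : Set (FreeProP p n)) ⊆ U := by
  obtain ⟨P, hP⟩ := ProPCompletion.exists_ker_proj_subset hU
  exact ⟨ProPCompletion.kerProj P, hP⟩

/-- An element of `F(n)` and its Fox derivatives can be approximated from the free group. -/
theorem exists_freeGroup_approximation (v : FreeProP p n) (W V : OpenNormalSubgroup (FreeProP p n))
    (m : ℕ) : ∃ f : FreeGroup (Fin n),
      (ProPCompletion.of p _ f : FreeProP p n ⧸ W.toSubgroup) = v ∧
      (ProPCompletion.of p _ f : FreeProP p n ⧸ V.toSubgroup) = v ∧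
      ∀ k, red p V m (groupRingMap p n (discreteFox k (MonoidAlgebra.single f 1))) =
        red p V m (foxDerivative p k (CompletedGroupRing.of p v)) := by
  have h1 : ∀ k : Fin n, ∀ᶠ x in 𝓝 v, red p V m (foxDerivative p k (CompletedGroupRing.of p x)) =
      red p V m (foxDerivative p k (CompletedGroupRing.of p v)) := fun k =>
    (((foxDerivative p k).continuous.comp continuous_of).tendsto v).eventually
      ((mem_nhds_iff _).2 ⟨V, m, fun _ hb => hb⟩)
  have h2 : ∀ U : OpenNormalSubgroup (FreeProP p n), ∀ᶠ x : FreeProP p n in 𝓝 v,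
      (x : FreeProP p n ⧸ U.toSubgroup) = (v : FreeProP p n ⧸ U.toSubgroup) := fun U => by
    have h3 : (fun x => v⁻¹ * x) ⁻¹' (U.toSubgroup : Set (FreeProP p n)) ∈ 𝓝 v :=
      (U.isOpen'.preimage (continuous_const_mul v⁻¹)).mem_nhds (by simp)
    filter_upwards [h3] with x hx
    exact (QuotientGroup.eq.2 hx).symm
  have h3 := (eventually_all.2 h1).and ((h2 W).and (h2 V))
  have h4 : Tendsto (fun x : FreeProP p n => v * x) (𝓝 1) (𝓝 v) := by
    simpa using (continuous_const_mul v).tendsto (1 : FreeProP p n)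
  obtain ⟨U, hU⟩ := exists_openNormal_le_of_mem_nhds (h4 h3)
  obtain ⟨f, hf⟩ := ProPCompletion.exists_of_mul_mem U v
  have h5 := hU (QuotientGroup.eq.1 hf.symm)
  simp only [Set.mem_preimage, mul_inv_cancel_left] at h5
  obtain ⟨h6, h7, h8⟩ := h5
  refine ⟨f, h7, h8, fun k => ?_⟩
  rw [← h6 k, ← foxDerivative_groupRingMap, groupRingMap_single]

/-- The closed set H \ W is disjoint from the compact set N, because H ∩ N = 1 and 1 ∈ W. It
therefore stays disjoint from N·U for some neighbourhood U of 1. -/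
theorem exists_openNormal_inf_sup_le {H N : Subgroup (FreeProP p n)} [N.Normal]
    (hH : IsClosed (H : Set (FreeProP p n))) (hN : IsClosed (N : Set (FreeProP p n)))
    (h : H ⊓ N = ⊥) (W : OpenNormalSubgroup (FreeProP p n)) :
    ∃ W' : OpenNormalSubgroup (FreeProP p n), W'.toSubgroup ≤ W.toSubgroup ∧
      H ⊓ (N ⊔ W'.toSubgroup) ≤ W.toSubgroup := by
  have hC : IsClosed ((H : Set (FreeProP p n)) \ W.toSubgroup) := hH.sdiff W.isOpen'
  obtain ⟨U, hU, hNU⟩ := compact_open_separated_mul_right hN.isCompact hC.isOpen_compl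
    (fun x hx hx' => hx'.2 (by
      have h1 : x ∈ H ⊓ N := ⟨hx'.1, hx⟩
      rw [h, Subgroup.mem_bot] at h1
      rw [h1]
      exact W.toSubgroup.one_mem))
  obtain ⟨W', hW'⟩ := exists_openNormal_le_of_mem_nhds hU
  refine ⟨W' ⊓ W, inf_le_right (a := W'.toSubgroup), fun x hx => ?_⟩
  obtain ⟨y, hy, z, hz, hyz⟩ := Subgroup.mem_sup_of_normal_right.1 hx.2
  by_contra hxW
  exact hNU (Set.mul_mem_mul hy (hW' hz.1)) (hyz ▸ ⟨hx.1, hxW⟩)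

/-- The abelianization of a subgroup of a finite quotient of `F(n)` has exponent a power of `p`. -/
theorem exists_pow_abelianization_eq_one (W : OpenNormalSubgroup (FreeProP p n))
    (M : Subgroup (FreeProP p n ⧸ W.toSubgroup)) :
    ∃ m : ℕ, ∀ a : Additive (Abelianization M), (p ^ m) • a = 0 := by
  obtain ⟨m, hm⟩ := ProPCompletion.exists_pow_mem W
  refine ⟨m, fun a => ?_⟩
  obtain ⟨x, hx⟩ : ∃ x : M, Abelianization.of x = a.toMul := QuotientGroup.mk_surjective a.toMul
  apply Additive.toMul.injective
  rw [toMul_nsmul, ← hx, ← map_pow]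
  have : x ^ p ^ m = 1 := by
    ext
    obtain ⟨y, hy⟩ := QuotientGroup.mk_surjective (x : FreeProP p n ⧸ W.toSubgroup)
    rw [Subgroup.coe_pow, ← hy, ← QuotientGroup.mk_pow]
    exact (QuotientGroup.eq_one_iff _).2 (hm y)
  rw [this, map_one, toMul_zero]

theorem mem_commutator_sup_of_foxDerivative_eq_zero (K : Set (Fin n)) (N : Subgroup (FreeProP p n))
    [N.Normal] (hN : IsClosed (N : Set (FreeProP p n)))
    (hKN : FreeProP.closedSubgroupOf p K ⊓ N = ⊥) {v : FreeProP p n} (hv : v ∈ N)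
    (h : ∀ k : Fin n, k ∉ K →
      quotientMap p N (foxDerivative p k (CompletedGroupRing.of p v)) = 0)
    (W : OpenNormalSubgroup (FreeProP p n)) : v ∈ ⁅N, N⁆ ⊔ W.toSubgroup := by
  obtain ⟨W', hW', hHW⟩ := exists_openNormal_inf_sup_le
    (Subgroup.isClosed_topologicalClosure _) hN hKN W
  let V : OpenNormalSubgroup (FreeProP p n) :=
    { toSubgroup := N ⊔ W'.toSubgroup
      isOpen' := Subgroup.isOpen_mono (H₁ := W'.toSubgroup) le_sup_right W'.isOpen'
      isNormal' := inferInstance }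
  have hNV : N ≤ V.toSubgroup := le_sup_left
  obtain ⟨s, hsH, hsV⟩ := exists_equivariant_representatives _ V.toSubgroup W.toSubgroup hHW
  -- As W' ≤ W, passing from N to V adds nothing modulo W, so commutators of M come from commutators
  -- of N.
  let M := V.toSubgroup.map (QuotientGroup.mk' W.toSubgroup)
  have hM : M = N.map (QuotientGroup.mk' W.toSubgroup) := by
    change (N ⊔ W'.toSubgroup).map _ = _
    rw [Subgroup.map_sup, sup_eq_left]
    rintro _ ⟨x, hx, rfl⟩
    have h1 : QuotientGroup.mk' W.toSubgroup x = 1 := (QuotientGroup.eq_one_iff x).2 (hW' hx)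
    rw [h1]
    exact Subgroup.one_mem _
  -- This m fixes the precision: with coefficients in ℤ/p^m, the reduction of the derivatives can
  -- act on the abelianization of M.
  obtain ⟨m, hm⟩ := exists_pow_abelianization_eq_one W M
  let _ : Module (ZMod (p ^ m)) (Additive (Abelianization M)) := AddCommGroup.zmodModule hm
  let α : FreeGroup (Fin n) →* FreeProP p n ⧸ V.toSubgroup :=
    (QuotientGroup.mk' V.toSubgroup).comp (ProPCompletion.of p _)
  let β : FreeGroup (Fin n) →* FreeProP p n ⧸ W.toSubgroup :=
    (QuotientGroup.mk' W.toSubgroup).comp (ProPCompletion.of p _)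
  let χ : M →* Multiplicative (Additive (Abelianization M)) := Abelianization.of
  have hs : ∀ w g, (s (α w * g))⁻¹ * β w * s g ∈ M := by
    intro w g
    induction g using QuotientGroup.induction_on with
    | H t =>
      obtain ⟨a, ha, hsa⟩ := hsV (ProPCompletion.of p _ w * t)
      obtain ⟨b, hb, hsb⟩ := hsV t
      refine ⟨a⁻¹ * b, V.toSubgroup.mul_mem (V.toSubgroup.inv_mem ha) hb, ?_⟩
      change _ = (s ((ProPCompletion.of p _ w * t : FreeProP p n) : FreeProP p n ⧸ V.toSubgroup))⁻¹ *
        ((ProPCompletion.of p _ w : FreeProP p n) : FreeProP p n ⧸ W.toSubgroup) * _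
      rw [hsa, hsb, ← QuotientGroup.mk_inv, ← QuotientGroup.mk_mul, ← QuotientGroup.mk_mul]
      change ((a⁻¹ * b : FreeProP p n) : FreeProP p n ⧸ W.toSubgroup) = _
      congr 1
      group
  obtain ⟨f, hfW, hfV, hfD⟩ := exists_freeGroup_approximation v W V m
  have hρ : ∀ w, ((red p V m).comp (groupRingMap p n).toRingHom) (MonoidAlgebra.single w 1) =
      MonoidAlgebra.single (α w) 1 := fun w =>
    (red_groupRingMap_single V m w 1).trans (by rw [Int.cast_one]; rfl)
  have hsum := sectionCocycle_eq_sum_translateSum α β χ s hs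
    ((red p V m).comp (groupRingMap p n).toRingHom) hρ f 1
  rw [Finset.sum_eq_zero] at hsum
  -- Since v ∈ N ≤ V, the approximation f is trivial in F/V, so at g = 1 the cocycle is the class of
  -- s(1)⁻¹ v s(1).
  · have hα : α f * 1 = 1 := by
      rw [mul_one]
      exact hfV.trans ((QuotientGroup.eq_one_iff v).2 (hNV hv))
    have hβ : β f = v := hfW
    have h1 : (⟨(s (α f * 1))⁻¹ * β f * s 1, hs f 1⟩ : M) ∈ commutator M := by
      rw [← Abelianization.ker_of, MonoidHom.mem_ker]
      exact hsum
    have h2 := Subgroup.mem_map_of_mem M.subtype h1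
    have hMM : (commutator M).map M.subtype = ⁅N, N⁆.map (QuotientGroup.mk' W.toSubgroup) := by
      rw [Subgroup.map_subtype_commutator, hM, Subgroup.map_commutator]
    rw [hMM] at h2
    have h3 : (s 1)⁻¹ * (v : FreeProP p n ⧸ W.toSubgroup) * s 1 ∈
        ⁅N, N⁆.map (QuotientGroup.mk' W.toSubgroup) := by
      rw [← hβ]
      refine (congrArg (fun g => (s g)⁻¹ * β f * s 1 ∈ _) hα).mp h2
    have hnormal : (⁅N, N⁆.map (QuotientGroup.mk' W.toSubgroup)).Normal :=
      Subgroup.Normal.map inferInstance _ (QuotientGroup.mk'_surjective _)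
    -- The representative s(1) need not be 1; normality removes the conjugation.
    have h4 := hnormal.conj_mem _ h3 (s 1)
    simp only [mul_assoc, mul_inv_cancel_left, mul_inv_cancel, mul_one] at h4
    have h5 : v ∈ (⁅N, N⁆.map (QuotientGroup.mk' W.toSubgroup)).comap
      (QuotientGroup.mk' W.toSubgroup) := h4
    rwa [Subgroup.comap_map_eq, QuotientGroup.ker_mk'] at h5
  · intro k _
    by_cases hk : k ∈ K
    -- For k ∈ K, equivariance gives s(x_k g) = x_k s(g), so the cocycle of x_k is zero.
    · have h1 : sectionCocycle α β χ s hs (FreeGroup.of k) = 0 := by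
        funext g
        have h2 : (⟨(s (α (FreeGroup.of k) * g))⁻¹ * β (FreeGroup.of k) * s g, hs _ g⟩ : M) = 1 := by
          ext
          have h3 : s (α (FreeGroup.of k) * g) = β (FreeGroup.of k) * s g :=
            hsH (FreeProP.gen p k) (subset_closure (Subgroup.subset_closure ⟨k, hk, rfl⟩)) g
          simp [h3, mul_assoc]
        rw [sectionCocycle, h2, map_one]
        rfl
      rw [h1]
      induction ((red p V m).comp (groupRingMap p n).toRingHom)
        (discreteFox k (MonoidAlgebra.single f 1)) using MonoidAlgebra.induction_linear with
      | zero => rw [map_zero]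
      | add b b' hb hb' => rw [map_add, hb, hb', add_zero]
      | single y z => rw [translateSum_single, Pi.zero_apply, smul_zero]
    -- For k ∉ K, the derivative of f agrees with that of v modulo p^m and V, and the latter
    -- vanishes already over F/N.
    · have h1 : ((red p V m).comp (groupRingMap p n).toRingHom)
          (discreteFox k (MonoidAlgebra.single f 1)) = 0 :=
        (hfD k).trans (red_eq_zero_of_quotientMap_eq_zero N V hNV m (h k hk))
      rw [h1, map_zero]

/-! ### Closures through open normal subgroups, and the closed derived series -/

theorem mem_topologicalClosure_of_forall_mem_sup {S : Subgroup (FreeProP p n)} {v : FreeProP p n}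
    (h : ∀ W : OpenNormalSubgroup (FreeProP p n), v ∈ S ⊔ W.toSubgroup) :
    v ∈ S.topologicalClosure := by
  refine mem_closure_iff_nhds_one.2 fun U hU => ?_
  obtain ⟨W, hW⟩ := exists_openNormal_le_of_mem_nhds hU
  obtain ⟨y, hy, z, hz, rfl⟩ := Subgroup.mem_sup_of_normal_right.1 (h W)
  refine ⟨y, hy, hW ?_⟩
  have h1 : y / (y * z) = y * z⁻¹ * y⁻¹ := by rw [div_eq_mul_inv, mul_inv_rev, mul_assoc]
  rw [h1]
  exact W.isNormal'.conj_mem _ (W.toSubgroup.inv_mem hz) y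

/-- The closed derived series of a subgroup of a topological group. -/
def closedDerivedSeries {G : Type*} [Group G] [TopologicalSpace G] [IsTopologicalGroup G]
    (R : Subgroup G) : ℕ → Subgroup G
  | 0 => R
  | i + 1 => ⁅closedDerivedSeries R i, closedDerivedSeries R i⁆.topologicalClosure

theorem closedDerivedSeries_normal {G : Type*} [Group G] [TopologicalSpace G]
    [IsTopologicalGroup G] (R : Subgroup G) [hR : R.Normal] (i : ℕ) :
    (closedDerivedSeries R i).Normal := by
  induction i with
  | zero => exact hR
  | succ i ih => exact Subgroup.is_normal_topologicalClosure _

theorem isClosed_closedDerivedSeries {G : Type*} [Group G] [TopologicalSpace G]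
    [IsTopologicalGroup G] {R : Subgroup G} (hR : IsClosed (R : Set G)) (i : ℕ) :
    IsClosed (closedDerivedSeries R i : Set G) := by
  cases i with
  | zero => exact hR
  | succ i => exact Subgroup.isClosed_topologicalClosure _

theorem closedDerivedSeries_succ_le {G : Type*} [Group G] [TopologicalSpace G]
    [IsTopologicalGroup G] {R : Subgroup G} [R.Normal] (hR : IsClosed (R : Set G)) (i : ℕ) :
    closedDerivedSeries R (i + 1) ≤ closedDerivedSeries R i := by
  have := closedDerivedSeries_normal R i
  exact Subgroup.topologicalClosure_minimal _ (Subgroup.commutator_le_left _ _)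
    (isClosed_closedDerivedSeries hR i)

/-- The closed derived series of a subgroup of `F(n)` has trivial intersection. -/
theorem eq_one_of_forall_mem_closedDerivedSeries (R : Subgroup (FreeProP p n)) {v : FreeProP p n}
    (h : ∀ i, v ∈ closedDerivedSeries R i) : v = 1 := by
  refine Subtype.ext (funext fun P => ?_)
  -- Taking closures does no harm: the preimage of a derived subgroup contains the open kernel of
  -- the projection, so it is open and hence closed.
  have hle : ∀ i, closedDerivedSeries R i ≤
      (derivedSeries (FreeGroup (Fin n) ⧸ P.toSubgroup) i).comap (ProPCompletion.proj p _ P) := by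
    intro i
    induction i with
    | zero => exact fun _ _ => Subgroup.mem_top _
    | succ i ih =>
      refine Subgroup.topologicalClosure_minimal _ ?_ (Subgroup.isClosed_of_isOpen _ ?_)
      · refine (Subgroup.commutator_mono ih ih).trans ?_
        rw [derivedSeries_succ, ← Subgroup.map_le_iff_le_comap, Subgroup.map_commutator]
        exact Subgroup.commutator_mono (Subgroup.map_comap_le _ _) (Subgroup.map_comap_le _ _)
      · refine Subgroup.isOpen_mono (H₁ := (ProPCompletion.kerProj P).toSubgroup) ?_
          (ProPCompletion.kerProj P).isOpen'
        exact Subgroup.ker_le_comap _ _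
  have : Finite (FreeGroup (Fin n) ⧸ P.toSubgroup) := ProPCompletion.finite_quotient P
  have hP : IsPGroup p (FreeGroup (Fin n) ⧸ P.toSubgroup) := IsPGroup.iff_card.2 P.index_eq
  have := hP.isNilpotent
  obtain ⟨i, hi⟩ := Group.IsSolvable.solvable (G := FreeGroup (Fin n) ⧸ P.toSubgroup)
  have h1 := hle i (h i)
  rw [hi] at h1
  exact h1

end Main

end FoxProP

theorem mainTheorem6 (p : ℕ) [Fact p.Prime] (n : ℕ) (K : Set (Fin n))
    (R : Subgroup (FoxProP.FreeProP p n)) [R.Normal]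
    (hR : IsClosed (R : Set (FoxProP.FreeProP p n))) :
    FoxProP.FreeProP.closedSubgroupOf p K ⊓ R = ⊥ ↔
      ∀ (N : Subgroup (FoxProP.FreeProP p n)) [N.Normal],
        IsClosed (N : Set (FoxProP.FreeProP p n)) → N ≤ R → ∀ v ∈ N,
          (∀ k : Fin n, k ∉ K →
            FoxProP.CompletedGroupRing.quotientMap p N
              (FoxProP.foxDerivative p k (FoxProP.CompletedGroupRing.of p v)) = 0) →
          v ∈ (⁅N, N⁆ : Subgroup (FoxProP.FreeProP p n)).topologicalClosure := by
  constructor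
  · intro h N _ hN hNR v hv hD
    have hKN : FoxProP.FreeProP.closedSubgroupOf p K ⊓ N = ⊥ :=
      le_bot_iff.1 (h ▸ inf_le_inf_left _ hNR)
    exact FoxProP.mem_topologicalClosure_of_forall_mem_sup
      (FoxProP.mem_commutator_sup_of_foxDerivative_eq_zero K N hN hKN hv hD)
  · intro h
    refine (Subgroup.eq_bot_iff_forall _).2 fun v hv => ?_
    have hle : ∀ i, FoxProP.closedDerivedSeries R i ≤ R := by
      intro i
      induction i with
      | zero => exact le_rfl
      | succ i ih => exact (FoxProP.closedDerivedSeries_succ_le hR i).trans ih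
    -- Each term of the series is a closed normal subgroup inside R, so the hypothesis with N equal
    -- to that term moves v to the next one.
    refine FoxProP.eq_one_of_forall_mem_closedDerivedSeries R fun i => ?_
    induction i with
    | zero => exact hv.2
    | succ i ih =>
      have := FoxProP.closedDerivedSeries_normal R i
      refine h _ (FoxProP.isClosed_closedDerivedSeries hR i) (hle i) v ih fun k hk => ?_
      rw [FoxProP.foxDerivative_of_eq_zero K hk hv.1, map_zero]
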